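/- Let $n\geq 0$ and let $M=B_n$ be the Artin--Tits monoid of type $B_n$, that is, the monoid generated by $a_1,\dots,a_n$ subject to the relations $a_ia_j=a_ja_i$ for $|i-j|>1$, $a_ia_ja_i=a_ja_ia_j$ for $|i-j|=1$ with $i,j\neq n$, and (if $n\geq 2$) $a_{n-1}a_na_{n-1}a_n=a_na_{n-1}a_na_{n-1}$ (for $n=0$ it is the trivial monoid). An atom of $M$ is an element $a\neq 1$ such that $a=bc$ with $b,c\in M$ implies $b=1$ or $c=1$. The length of an element of $M$ is the length of a shortest word in the atoms representing it. For $k\ge 0$ let $M_k$ be the set of elements of $M$ of length $k$. Then every $M_k$ is finite. Let $g_M(t)=\sum_{k\geq 0}|M_k|\,t^k\in\mathbb Z[[t]]$ be the growth function of $M$. Let $\mathcal M^{\mathcal B}_n$ be the square matrix of order $n+1$ whose entry $(i,n+1)$ equals $t^{(n-i+1)^2}$ for all $1\le i\le n+1$, and whose entry $(i,j)$ for $j\leq n$ equals $t^{\binom{j-i+1}{2}}$ if $j-i+1\geq 0$, and $0$ otherwise, where $\binom{k}{2}=k(k-1)/2$. Then $$g_M(t)=|\mathcal M^{\mathcal B}_n|^{-1},$$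 where $|\cdot|$ is the determinant; that is, $g_M(t)\cdot|\mathcal M^{\mathcal B}_n|=1$ in $\mathbb Z[[t]]$. -/

import Mathlib

/-- The atoms of a monoid: the nontrivial elements that cannot be decomposed as a product of two
nontrivial elements. -/
def monoidAtoms (M : Type*) [Monoid M] : Set M :=
  {a | a ≠ 1 ∧ ∀ b c : M, a = b * c → b = 1 ∨ c = 1}

/-- `HasAtomWord a k`: the element `a` is represented by a word of length `k` in the atoms. -/
def HasAtomWord {M : Type*} [Monoid M] (a : M) (k : ℕ) : Prop :=
  ∃ w : List M, (∀ x ∈ w, x ∈ monoidAtoms M) ∧ w.prod = a ∧ w.length = k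

/-- The set `M_k` of elements of length `k`, the length of an element being the length of a
shortest word in the atoms representing it. -/
def atomSphere (M : Type*) [Monoid M] (k : ℕ) : Set M :=
  {a | IsLeast {l : ℕ | HasAtomWord a l} k}

/-- The growth function `∑ₖ |M_k| tᵏ` of a monoid with respect to its atoms, as a formal power
series (meaningful when every `M_k` is finite). -/
noncomputable def growthSeries (M : Type*) [Monoid M] : PowerSeries ℤ :=
  PowerSeries.mk fun k => ((atomSphere M k).ncard : ℤ)

/-- The defining relations of the Artin–Tits monoid of type `Bₙ`. The generators `a₁, …, aₙ` are
indexed from `0`, so that the generator `aₙ` has index `n - 1`. -/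
inductive ArtinTitsBRel (n : ℕ) : FreeMonoid (Fin n) → FreeMonoid (Fin n) → Prop
  | comm (i j : Fin n) (h : (i : ℕ) + 1 < (j : ℕ)) :
      ArtinTitsBRel n
        (FreeMonoid.of i * FreeMonoid.of j)
        (FreeMonoid.of j * FreeMonoid.of i)
  | braid (i j : Fin n) (h : (i : ℕ) + 1 = (j : ℕ)) (hj : (j : ℕ) + 1 ≠ n) :
      ArtinTitsBRel n
        (FreeMonoid.of i * FreeMonoid.of j * FreeMonoid.of i)
        (FreeMonoid.of j * FreeMonoid.of i * FreeMonoid.of j)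
  | four (i j : Fin n) (h : (i : ℕ) + 1 = (j : ℕ)) (hj : (j : ℕ) + 1 = n) :
      ArtinTitsBRel n
        (FreeMonoid.of i * FreeMonoid.of j * FreeMonoid.of i * FreeMonoid.of j)
        (FreeMonoid.of j * FreeMonoid.of i * FreeMonoid.of j * FreeMonoid.of i)

/-- The Artin–Tits monoid of type `Bₙ`. -/
abbrev ArtinTitsB (n : ℕ) : Type := PresentedMonoid (ArtinTitsBRel n)

/-- The square matrix of order `n + 1` attached to type `Bₙ`, with `t = X`. In terms of the indices
`i, j` starting from `1`, the entry `(i, n + 1)` is `t ^ ((n - i + 1) ^ 2)`, and for `j ≤ n` the entry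
`(i, j)` is `t ^ (j - i + 1).choose 2` if `j - i + 1 ≥ 0` and `0` otherwise. -/
noncomputable def matrixB (n : ℕ) : Matrix (Fin (n + 1)) (Fin (n + 1)) (Polynomial ℤ) :=
  Matrix.of fun i j =>
    if (j : ℕ) = n then Polynomial.X ^ ((n - (i : ℕ)) ^ 2)
    else if (i : ℕ) ≤ (j : ℕ) + 1 then Polynomial.X ^ (((j : ℕ) + 1 - (i : ℕ)).choose 2)
    else 0

/-! For a set `T` of generators with least common right multiple `d`, the elements left-divisible by
all of `T` are exactly `d * M`. By left cancellation they contribute `t ^ len d * g`, where `g` is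
the growth series. Only `1` is divisible by no generator, so inclusion–exclusion gives `1 = g * ∑
(-1) ^ |T| * t ^ len d`. Splitting `T` into maximal intervals writes `d` as a product of commuting
Garside elements: an interval of `l` generators has type A and length `(l + 1).choose 2` if it
avoids the last generator, and type B and length `l ^ 2` if it contains it. Expanding the
determinant along its first column performs the same sum, one generator at a time
(`genFun_divisorPattern`, `det_shiftedMatrix_succ`).

The algebraic input is Garside's lemma `meets_of_eq`: an equality `gen i * x = gen j * y` is a right
multiple of the defining relation between `i` and `j`. It is proved by induction on length. A chain
of relations may pass through a word beginning with a third letter `k`, so the rank three case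
(`Meets.trans`) must be settled; the types are A₃, B₃ and those with an isolated vertex.
Cancellation follows, and the lcms of intervals are then built explicitly (`IsChain.isLcm`). -/

section Cube

/-! ### Cube conditions for three generators, in an abstract monoid with additive length. -/

variable {M : Type*} [Monoid M] {len : M → ℕ} {N : ℕ}

/-- Among elements `x` of length less than `N`, the equalities `p * x = q * y` are exactly the
multiples of the equality `p * u = q * v`. -/
def LcmBelow (len : M → ℕ) (N : ℕ) (p q u v : M) : Prop :=
  ∀ x y, len x < N → p * x = q * y → ∃ z, x = u * z ∧ y = v * z

theorem LcmBelow.cancel {p : M} (k : LcmBelow len N p p 1 1) {x y : M} (hx : len x < N)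
    (h : p * x = p * y) : x = y := by
  obtain ⟨z, rfl, rfl⟩ := k x y hx h
  rfl

/-- The hypothesis on `p` is applied to `q * x`, which is why the bound drops by `len q`. -/
theorem LcmBelow.mul_of_commute {p q r : M} (hl : ∀ x y : M, len (x * y) = len x + len y)
    (hp : LcmBelow len N p r r p) (hq : LcmBelow len N q r r q) :
    LcmBelow len (N - len q) (p * q) r r (p * q) := by
  intro x y hx h
  rw [mul_assoc] at h
  obtain ⟨z, h1, rfl⟩ := hp _ _ (by rw [hl]; omega) h
  obtain ⟨t, rfl, rfl⟩ := hq _ _ (by omega) h1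
  exact ⟨t, rfl, (mul_assoc ..).symm⟩

variable {p q r x w z z' : M}

/-- This and the following lemmas share one pattern: two equalities through an intermediate
generator, each a multiple of its lcm relation, force the same for the outer pair. The outer
equality may have length beyond the reach of the `LcmBelow` hypotheses, but stripping a letter
brings it below `N`. Here `r` is the isolated vertex; in the next lemma it is again isolated, but is
the intermediate generator. -/
theorem cube_of_commute_middle {u v : M}
    (hpq : p * u = q * v) (hru : u * r = r * u)
    (k : LcmBelow len N v r r v)
    (hx : x = u * z) (hy : v * z = r * z') (hw : w = q * z') (hz : len z < N) :
    ∃ s, x = r * s ∧ w = p * s := by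
  subst hx hw
  obtain ⟨t, rfl, rfl⟩ := k _ _ hz hy
  refine ⟨u * t, ?_, ?_⟩
  · rw [← mul_assoc, ← mul_assoc, hru]
  · rw [← mul_assoc, ← mul_assoc, hpq]

theorem cube_of_commute_outer {u v : M} (hru : r * u = u * r) (hrv : r * v = v * r)
    (k : LcmBelow len N p q u v) (hx : x = r * z) (hy : p * z = q * z') (hw : w = r * z')
    (hz : len z < N) : ∃ s, x = u * s ∧ w = v * s := by
  subst hx hw
  obtain ⟨t, rfl, rfl⟩ := k _ _ hz hy
  exact ⟨r * t, by rw [← mul_assoc, ← mul_assoc, hru], by rw [← mul_assoc, ← mul_assoc, hrv]⟩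

theorem cube_threeThree_middle
    (hl : ∀ x y : M, len (x * y) = len x + len y)
    (hp : len p = 1) (hq : len q = 1) (hr : len r = 1)
    (pq : p * q * p = q * p * q) (qr : q * r * q = r * q * r) (pr : p * r = r * p)
    (cq : LcmBelow len N q q 1 1)
    (kpr : LcmBelow len N p r r p) (kpq : LcmBelow len N p q (q * p) (p * q))
    (kqr : LcmBelow len N q r (r * q) (q * r))
    (hN : len x ≤ N) (hx : x = q * p * z) (hy : p * q * z = r * q * z')
    (hw : w = q * r * z') :
    ∃ s, x = r * s ∧ w = p * s := by
  simp only [LcmBelow, mul_assoc] at kpr kpq kqr hx hy hw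
  subst hx hw
  simp only [hl, hp, hq] at hN
  obtain ⟨u, h1, h2⟩ := kpr _ _ (by simp only [hl, hq]; omega) hy
  obtain ⟨v, rfl, rfl⟩ := kqr _ _ (by omega) h1
  simp only [hl, hr, hq] at hN
  obtain ⟨s, h3, rfl⟩ := kpq _ _ (by
    have := congrArg len h2; simp only [hl, hp, hr] at this ⊢; omega) h2.symm
  replace h3 := cq.cancel (by simp only [hl, hr]; omega) h3
  obtain ⟨t, rfl, rfl⟩ := kpr _ _ (by
    have := congrArg len h3; simp only [hl, hp, hr] at this ⊢; omega) h3.symm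
  replace pq (z : M) : p * (q * (p * z)) = q * (p * (q * z)) := by
    simpa only [mul_assoc] using congrArg (· * z) pq
  replace qr (z : M) : q * (r * (q * z)) = r * (q * (r * z)) := by
    simpa only [mul_assoc] using congrArg (· * z) qr
  replace pr (z : M) : p * (r * z) = r * (p * z) := by
    simpa only [mul_assoc] using congrArg (· * z) pr
  clear * - pq qr pr
  -- The common value `p * x` has become the Garside element of type A₃ times `t`; the witness is
  -- what follows `p * r` in it.
  exact ⟨q * (p * (r * (q * t))), by grind only, by grind only⟩

/-- Type A₃ with the intermediate generator `q` at an end of the diagram `q – p – r`. -/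
theorem cube_threeThree_outer
    (hl : ∀ x y : M, len (x * y) = len x + len y)
    (hp : len p = 1) (hq : len q = 1) (hr : len r = 1)
    (pq : p * q * p = q * p * q) (pr : p * r * p = r * p * r) (qr : q * r = r * q)
    (kpr : LcmBelow len N p r (r * p) (p * r)) (kpq : LcmBelow len N p q (q * p) (p * q))
    (kqr : LcmBelow len N q r r q)
    (hN : len x ≤ N) (hx : x = q * p * z) (hy : p * q * z = r * z') (hw : w = q * z') :
    ∃ s, x = r * p * s ∧ w = p * r * s := by
  simp only [LcmBelow, mul_assoc] at kpr kpq kqr hx hy hw ⊢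
  subst hx hw
  simp only [hl, hp, hq] at hN
  obtain ⟨u, h1, rfl⟩ := kpr _ _ (by simp only [hl, hq]; omega) hy
  obtain ⟨v, rfl, h2⟩ := kqr _ _ (by omega) h1
  simp only [hl, hr] at hN
  obtain ⟨s, rfl, rfl⟩ := kpq _ _ (by
    have := congrArg len h2; simp only [hl, hp, hq] at this ⊢; omega) h2
  replace pq (z : M) : p * (q * (p * z)) = q * (p * (q * z)) := by
    simpa only [mul_assoc] using congrArg (· * z) pq
  replace pr (z : M) : p * (r * (p * z)) = r * (p * (r * z)) := by
    simpa only [mul_assoc] using congrArg (· * z) pr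
  replace qr (z : M) : q * (r * z) = r * (q * z) := by
    simpa only [mul_assoc] using congrArg (· * z) qr
  clear * - pq qr pr
  exact ⟨q * (p * (r * s)), by grind only, by grind only⟩

theorem cube_threeFour_middle
    (hl : ∀ x y : M, len (x * y) = len x + len y)
    (hp : len p = 1) (hq : len q = 1) (hr : len r = 1)
    (pq : p * q * p = q * p * q) (qr : q * r * q * r = r * q * r * q) (pr : p * r = r * p)
    (cq : LcmBelow len N q q 1 1) (cr : LcmBelow len N r r 1 1)
    (kpr : LcmBelow len N p r r p) (kpq : LcmBelow len N p q (q * p) (p * q))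
    (kqr : LcmBelow len N q r (r * q * r) (q * r * q))
    (hN : len x ≤ N) (hx : x = q * p * z) (hy : p * q * z = r * q * r * z')
    (hw : w = q * r * q * z') :
    ∃ s, x = r * s ∧ w = p * s := by
  simp only [LcmBelow, mul_assoc] at kpr kpq kqr hx hy hw
  subst hx hw
  simp only [hl, hp, hq] at hN
  obtain ⟨u, h1, h2⟩ := kpr _ _ (by simp only [hl, hq]; omega) hy
  obtain ⟨v, rfl, rfl⟩ := kqr _ _ (by omega) h1
  simp only [hl, hq, hr] at hN
  obtain ⟨s, h3, h4⟩ := kpq _ _ (by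
    have := congrArg len h2; simp only [hl, hp, hq, hr] at this ⊢; omega) h2.symm
  replace h3 := cq.cancel (by simp only [hl, hr, hq]; omega) h3
  obtain ⟨t, rfl, h5⟩ := kpr _ _ (by
    have := congrArg len h3; simp only [hl, hp, hq, hr] at this ⊢; omega) h3.symm
  obtain ⟨m, rfl, rfl⟩ := kpq _ _ (by
    have := congrArg len h5; simp only [hl, hp, hq] at this ⊢; omega) h5.symm
  simp only [hl, hp, hq] at hN
  obtain ⟨o, h6, rfl⟩ := kpr _ _ (by
    have := congrArg len h4; simp only [hl, hp, hq, hr] at this ⊢; omega) h4.symm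
  obtain ⟨f, h7, rfl⟩ := kqr _ _ (by simp only [hl, hp, hq, hr]; omega) h6
  replace h7 := cq.cancel (by simp only [hl, hp]; omega)
    (cr.cancel (by simp only [hl, hp, hq]; omega) h7)
  obtain ⟨g, rfl, rfl⟩ := kpr _ _ (by omega) h7
  replace pq (z : M) : p * (q * (p * z)) = q * (p * (q * z)) := by
    simpa only [mul_assoc] using congrArg (· * z) pq
  replace qr (z : M) : q * (r * (q * (r * z))) = r * (q * (r * (q * z))) := by
    simpa only [mul_assoc] using congrArg (· * z) qr
  replace pr (z : M) : p * (r * z) = r * (p * z) := by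
    simpa only [mul_assoc] using congrArg (· * z) pr
  clear * - pq qr pr
  -- As for A₃: `p * x` is the Garside element of type B₃, of length 9, times `g`.
  exact ⟨q * (p * (r * (q * (p * (r * (q * g)))))), by grind only, by grind only⟩

/-- Type B₃ on `p – q = r`; the intermediate generator is `p`, the end of the simple edge, and the
common value is `q * x`. -/
theorem cube_threeFour_short
    (hl : ∀ x y : M, len (x * y) = len x + len y)
    (hp : len p = 1) (hq : len q = 1) (hr : len r = 1)
    (pq : p * q * p = q * p * q) (qr : q * r * q * r = r * q * r * q) (pr : p * r = r * p)
    (kpr : LcmBelow len N p r r p) (kpq : LcmBelow len N p q (q * p) (p * q))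
    (kqr : LcmBelow len N q r (r * q * r) (q * r * q))
    (hN : len x ≤ N) (hx : x = p * q * z) (hy : q * p * z = r * z') (hw : w = p * z') :
    ∃ s, x = r * q * r * s ∧ w = q * r * q * s := by
  simp only [LcmBelow, mul_assoc] at kpr kpq kqr hx hy hw ⊢
  subst hx hw
  simp only [hl, hp, hq] at hN
  obtain ⟨u, h1, rfl⟩ := kqr _ _ (by simp only [hl, hp]; omega) hy
  obtain ⟨v, rfl, h2⟩ := kpr _ _ (by omega) h1
  simp only [hl, hr] at hN
  obtain ⟨s, rfl, h3⟩ := kpq _ _ (by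
    have := congrArg len h2; simp only [hl, hp, hq, hr] at this ⊢; omega) h2.symm
  simp only [hl, hp, hq] at hN
  obtain ⟨t, h4, rfl⟩ := kpr _ _ (by
    have := congrArg len h3; simp only [hl, hp, hq, hr] at this ⊢; omega) h3.symm
  obtain ⟨m, rfl, rfl⟩ := kqr _ _ (by omega) h4
  replace pq (z : M) : p * (q * (p * z)) = q * (p * (q * z)) := by
    simpa only [mul_assoc] using congrArg (· * z) pq
  replace qr (z : M) : q * (r * (q * (r * z))) = r * (q * (r * (q * z))) := by
    simpa only [mul_assoc] using congrArg (· * z) qr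
  replace pr (z : M) : p * (r * z) = r * (p * z) := by
    simpa only [mul_assoc] using congrArg (· * z) pr
  clear * - pq qr pr
  exact ⟨p * (q * (r * (q * (p * m)))), by grind only, by grind only⟩

/-- Type B₃ on `p – q = r`; the intermediate generator is `r`, the end of the double edge. -/
theorem cube_threeFour_long
    (hl : ∀ x y : M, len (x * y) = len x + len y)
    (hp : len p = 1) (hq : len q = 1) (hr : len r = 1)
    (pq : p * q * p = q * p * q) (qr : q * r * q * r = r * q * r * q) (pr : p * r = r * p)
    (cq : LcmBelow len N q q 1 1)
    (kpr : LcmBelow len N p r r p) (kpq : LcmBelow len N p q (q * p) (p * q))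
    (kqr : LcmBelow len N q r (r * q * r) (q * r * q))
    (hN : len x ≤ N) (hx : x = r * z) (hy : p * z = q * r * q * z') (hw : w = r * q * r * z') :
    ∃ s, x = q * p * s ∧ w = p * q * s := by
  simp only [LcmBelow, mul_assoc] at kpr kpq kqr hx hy hw ⊢
  subst hx hw
  simp only [hl, hr] at hN
  obtain ⟨u, rfl, h1⟩ := kpq _ _ (by omega) hy
  simp only [hl, hp, hq] at hN
  obtain ⟨s, h2, h3⟩ := kpr _ _ (by
    have := congrArg len h1; simp only [hl, hp, hq, hr] at this ⊢; omega) h1.symm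
  obtain ⟨t, rfl, rfl⟩ := kpq _ _ (by
    have := congrArg len h2; simp only [hl, hq, hr] at this; omega) h3.symm
  obtain ⟨v, rfl, h4⟩ := kqr _ _ (by omega) h2
  simp only [hl, hr, hq] at hN
  obtain ⟨m, rfl, h5⟩ := kpr _ _ (by
    have := congrArg len h4; simp only [hl, hp, hq, hr] at this ⊢; omega) (cq.cancel (by
    have := congrArg len h4; simp only [hl, hp, hq, hr] at this ⊢; omega) h4)
  obtain ⟨f, rfl, rfl⟩ := kpq _ _ (by
    have := congrArg len h5; simp only [hl, hp, hq] at this ⊢; omega) h5.symm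
  replace pq (z : M) : p * (q * (p * z)) = q * (p * (q * z)) := by
    simpa only [mul_assoc] using congrArg (· * z) pq
  replace qr (z : M) : q * (r * (q * (r * z))) = r * (q * (r * (q * z))) := by
    simpa only [mul_assoc] using congrArg (· * z) qr
  replace pr (z : M) : p * (r * z) = r * (p * z) := by
    simpa only [mul_assoc] using congrArg (· * z) pr
  clear * - pq qr pr
  exact ⟨r * (q * (p * (r * (q * (r * f))))), by grind only, by grind only⟩

end Cube

/-! ### Length, Coxeter graph and right complements in type B. -/

namespace ArtinTitsB

variable {n : ℕ}

/-- The generator of `ArtinTitsB n` of index `i`. -/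
def gen (i : Fin n) : ArtinTitsB n := PresentedMonoid.of _ i

/-- The length of an element: the number of letters of any word in the generators. -/
def len (x : ArtinTitsB n) : ℕ :=
  (PresentedMonoid.lift (rels := ArtinTitsBRel n) (fun _ => Multiplicative.ofAdd 1)
    (by rintro _ _ (_ | _ | _) <;> simp) x).toAdd

@[simp] theorem len_one : len (1 : ArtinTitsB n) = 0 := by simp [len]

@[simp] theorem len_mul (x y : ArtinTitsB n) : len (x * y) = len x + len y := by simp [len]

@[simp] theorem len_gen (i : Fin n) : len (gen i) = 1 := by simp [len, gen]

@[simp] theorem len_mk (w : FreeMonoid (Fin n)) :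
    len (PresentedMonoid.mk (ArtinTitsBRel n) w) = w.length := by
  induction w with
  | one => simp
  | of x => exact len_gen x
  | mul x y hx hy => simp [hx, hy]

/-- The generators `i` and `j` commute. -/
def Far (i j : Fin n) : Prop := (i : ℕ) + 1 < j ∨ (j : ℕ) + 1 < i

/-- The generators `i` and `j` satisfy a braid relation of length three. -/
def Adj (i j : Fin n) : Prop :=
  ((i : ℕ) + 1 = j ∧ (j : ℕ) + 1 ≠ n) ∨ ((j : ℕ) + 1 = i ∧ (i : ℕ) + 1 ≠ n)

/-- The generators `i` and `j` satisfy a braid relation of length four. -/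
def Four (i j : Fin n) : Prop :=
  ((i : ℕ) + 1 = j ∧ (j : ℕ) + 1 = n) ∨ ((j : ℕ) + 1 = i ∧ (i : ℕ) + 1 = n)

theorem eq_or_far_or_adj_or_four (i j : Fin n) : i = j ∨ Far i j ∨ Adj i j ∨ Four i j := by
  rw [Far, Adj, Four, Fin.ext_iff]; omega

theorem Far.symm {i j : Fin n} (h : Far i j) : Far j i := by rw [Far] at *; omega
theorem Adj.symm {i j : Fin n} (h : Adj i j) : Adj j i := by rw [Adj] at *; omega
theorem Four.symm {i j : Fin n} (h : Four i j) : Four j i := by rw [Four] at *; omega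

theorem Far.comm {i j : Fin n} (h : Far i j) : gen i * gen j = gen j * gen i := by
  rcases h with h | h
  · exact PresentedMonoid.mk_eq_mk_of_rel (.comm i j h)
  · exact (PresentedMonoid.mk_eq_mk_of_rel (.comm j i h)).symm

theorem Adj.braid {i j : Fin n} (h : Adj i j) :
    gen i * gen j * gen i = gen j * gen i * gen j := by
  rcases h with ⟨h, h'⟩ | ⟨h, h'⟩
  · exact PresentedMonoid.mk_eq_mk_of_rel (.braid i j h h')
  · exact (PresentedMonoid.mk_eq_mk_of_rel (.braid j i h h')).symm

theorem Four.braid {i j : Fin n} (h : Four i j) :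
    gen i * gen j * gen i * gen j = gen j * gen i * gen j * gen i := by
  rcases h with ⟨h, h'⟩ | ⟨h, h'⟩
  · exact PresentedMonoid.mk_eq_mk_of_rel (.four i j h h')
  · exact (PresentedMonoid.mk_eq_mk_of_rel (.four j i h h')).symm

open Classical in
/-- The right complement of `gen i` by `gen j`: the element `u` such that `gen i * u` is the least
common right multiple of `gen i` and `gen j`. -/
noncomputable def compl (i j : Fin n) : ArtinTitsB n :=
  if i = j then 1
  else if Far i j then gen j
  else if Adj i j then gen j * gen i
  else gen j * gen i * gen j

@[simp] theorem compl_self (i : Fin n) : compl i i = 1 := if_pos rfl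

theorem Far.compl_eq {i j : Fin n} (h : Far i j) : compl i j = gen j := by
  rw [compl, if_neg (by rintro rfl; rw [Far] at h; omega), if_pos h]

theorem Adj.compl_eq {i j : Fin n} (h : Adj i j) : compl i j = gen j * gen i := by
  rw [compl, if_neg (by rintro rfl; rw [Adj] at h; omega),
    if_neg (by rw [Adj] at h; rw [Far]; omega), if_pos h]

theorem Four.compl_eq {i j : Fin n} (h : Four i j) : compl i j = gen j * gen i * gen j := by
  rw [compl, if_neg (by rintro rfl; rw [Four] at h; omega),
    if_neg (by rw [Four] at h; rw [Far]; omega), if_neg (by rw [Four] at h; rw [Adj]; omega)]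

theorem gen_mul_compl (i j : Fin n) : gen i * compl i j = gen j * compl j i := by
  rcases eq_or_far_or_adj_or_four i j with rfl | h | h | h
  · rfl
  · rw [h.compl_eq, h.symm.compl_eq, h.comm]
  · simpa only [h.compl_eq, h.symm.compl_eq, mul_assoc] using h.braid
  · simpa only [h.compl_eq, h.symm.compl_eq, mul_assoc] using h.braid

/-- The equality `gen i * x = gen j * y` is a multiple of
`gen i * compl i j = gen j * compl j i`. -/
def Meets (i : Fin n) (x : ArtinTitsB n) (j : Fin n) (y : ArtinTitsB n) : Prop :=
  ∃ z, x = compl i j * z ∧ y = compl j i * z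

theorem Meets.symm {i j : Fin n} {x y : ArtinTitsB n} (h : Meets i x j y) : Meets j y i x := by
  obtain ⟨z, hx, hy⟩ := h
  exact ⟨z, hy, hx⟩

theorem Meets.eq {i j : Fin n} {x y : ArtinTitsB n} (h : Meets i x j y) :
    gen i * x = gen j * y := by
  obtain ⟨z, rfl, rfl⟩ := h
  rw [← mul_assoc, ← mul_assoc, gen_mul_compl]

theorem meets_self {i : Fin n} {x y : ArtinTitsB n} : Meets i x i y ↔ x = y := by
  simp [Meets, eq_comm]

/-- Every equality `gen i * x = gen j * y` with `len x < N` is a multiple of the defining one. -/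
def AllBelow (n N : ℕ) : Prop :=
  ∀ i j : Fin n, LcmBelow len N (gen i) (gen j) (compl i j) (compl j i)

theorem AllBelow.cancel {N : ℕ} (K : AllBelow n N) (i : Fin n) :
    LcmBelow len N (gen i) (gen i) 1 1 := by
  simpa using K i i

theorem AllBelow.far {N : ℕ} (K : AllBelow n N) {i j : Fin n} (h : Far i j) :
    LcmBelow len N (gen i) (gen j) (gen j) (gen i) := by
  simpa only [h.compl_eq, h.symm.compl_eq] using K i j

theorem AllBelow.adj {N : ℕ} (K : AllBelow n N) {i j : Fin n} (h : Adj i j) :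
    LcmBelow len N (gen i) (gen j) (gen j * gen i) (gen i * gen j) := by
  simpa only [h.compl_eq, h.symm.compl_eq] using K i j

theorem AllBelow.four {N : ℕ} (K : AllBelow n N) {i j : Fin n} (h : Four i j) :
    LcmBelow len N (gen i) (gen j) (gen j * gen i * gen j) (gen i * gen j * gen i) := by
  simpa only [h.compl_eq, h.symm.compl_eq] using K i j

theorem len_compl (i j : Fin n) : len (compl i j) = len (compl j i) := by
  have := congrArg len (gen_mul_compl i j)
  simpa using this

theorem one_le_len_compl {i j : Fin n} (hij : i ≠ j) : 1 ≤ len (compl i j) := by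
  rcases eq_or_far_or_adj_or_four i j with h | h | h | h
  · exact absurd h hij
  all_goals simp [h.compl_eq]

theorem compl_commute {i j k : Fin n} (hi : Far i k) (hj : Far j k) :
    compl i j * gen k = gen k * compl i j := by
  have hi : Commute (gen i) (gen k) := hi.comm
  have hj : Commute (gen j) (gen k) := hj.comm
  change Commute _ _
  rcases eq_or_far_or_adj_or_four i j with rfl | h | h | h
  · simp
  · simpa only [h.compl_eq]
  · rw [h.compl_eq]; exact hj.mul_left hi
  · rw [h.compl_eq]; exact (hj.mul_left hi).mul_left hj

/-- Each letter of the complement after the first costs one unit of the bound. -/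
theorem AllBelow.compl_commute {N : ℕ} (K : AllBelow n N) {i j k : Fin n} (hij : i ≠ j)
    (hi : Far i k) (hj : Far j k) :
    LcmBelow len (N + 1 - len (compl i j)) (compl i j) (gen k) (gen k) (compl i j) := by
  have h2 : LcmBelow len (N - len (gen i)) (gen j * gen i) (gen k) (gen k) (gen j * gen i) :=
    (K.far hj).mul_of_commute len_mul (K.far hi)
  rcases eq_or_far_or_adj_or_four i j with h | h | h | h
  · exact absurd h hij
  · simpa [h.compl_eq] using K.far hj
  · rw [h.compl_eq]
    simpa using h2
  · rw [h.compl_eq]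
    have h3 : LcmBelow len (N - len (gen i) - len (gen j)) (gen j * gen i * gen j) (gen k) (gen k)
        (gen j * gen i * gen j) := by
      refine LcmBelow.mul_of_commute len_mul h2 ?_
      exact fun x y hx h => K.far hj x y (by omega) h
    simpa [Nat.sub_sub] using h3

theorem AllBelow.compl_cancel {N : ℕ} (K : AllBelow n N) {i j : Fin n} {x y : ArtinTitsB n}
    (hx : len (compl i j) + len x ≤ N) (h : compl i j * x = compl i j * y) : x = y := by
  rcases eq_or_far_or_adj_or_four i j with rfl | h' | h' | h'
  · simpa using h
  all_goals
    simp only [h'.compl_eq, mul_assoc, len_mul, len_gen] at h hx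
  · exact (K.cancel j).cancel (by omega) h
  · replace h := (K.cancel j).cancel (by simp; omega) h
    exact (K.cancel i).cancel (by omega) h
  · replace h := (K.cancel j).cancel (by simp; omega) h
    replace h := (K.cancel i).cancel (by simp; omega) h
    exact (K.cancel j).cancel (by omega) h

/-! ### Transitivity of `Meets`, by rank three type. -/

theorem Meets.trans_of_far_of_far {N : ℕ} (K : AllBelow n N) {i j k : Fin n}
    {x y w : ArtinTitsB n} (hx : len x ≤ N) (h₁ : Meets i x j y) (h₂ : Meets j y k w)
    (hij : i ≠ j) (hjk : Far j k) (hik : Far i k) : Meets i x k w := by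
  obtain ⟨z, rfl, rfl⟩ := h₁
  obtain ⟨z', hy, rfl⟩ := h₂
  rw [hjk.compl_eq] at hy
  rw [Meets, hjk.symm.compl_eq, hik.compl_eq, hik.symm.compl_eq]
  refine cube_of_commute_middle (gen_mul_compl i j) (ArtinTitsB.compl_commute hik hjk)
    (K.compl_commute hij.symm hjk hik) rfl hy rfl ?_
  rw [len_mul] at hx
  have := len_compl i j
  have := one_le_len_compl hij
  omega

theorem Meets.trans_of_far_far {N : ℕ} (K : AllBelow n N) {i j k : Fin n}
    {x y w : ArtinTitsB n} (hx : len x ≤ N) (h₁ : Meets i x j y) (h₂ : Meets j y k w)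
    (hij : Far i j) (hjk : Far j k) : Meets i x k w := by
  obtain ⟨z, rfl, rfl⟩ := h₁
  obtain ⟨z', hy, rfl⟩ := h₂
  rw [hij.symm.compl_eq, hjk.compl_eq] at hy
  rw [hij.compl_eq] at hx ⊢
  rw [hjk.symm.compl_eq]
  refine cube_of_commute_outer (ArtinTitsB.compl_commute hij hjk.symm).symm
    (ArtinTitsB.compl_commute hjk.symm hij).symm (K i k) rfl hy rfl ?_
  rw [len_mul, len_gen] at hx
  omega

theorem Meets.trans_of_adj_adj {N : ℕ} (K : AllBelow n N) {i j k : Fin n}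
    {x y w : ArtinTitsB n} (hx : len x ≤ N) (h₁ : Meets i x j y) (h₂ : Meets j y k w)
    (hij : Adj i j) (hjk : Adj j k) (hik : Far i k) : Meets i x k w := by
  obtain ⟨z, hxz, rfl⟩ := h₁
  obtain ⟨z', hy, hw⟩ := h₂
  simp only [Meets, hij.compl_eq, hij.symm.compl_eq, hjk.compl_eq, hjk.symm.compl_eq,
    hik.compl_eq, hik.symm.compl_eq] at *
  exact cube_threeThree_middle len_mul (len_gen i) (len_gen j) (len_gen k) hij.braid hjk.braid
    hik.comm (K.cancel j) (K.far hik) (K.adj hij) (K.adj hjk) hx hxz hy hw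

theorem Meets.trans_of_adj_far_adj {N : ℕ} (K : AllBelow n N) {i j k : Fin n}
    {x y w : ArtinTitsB n} (hx : len x ≤ N) (h₁ : Meets i x j y) (h₂ : Meets j y k w)
    (hij : Adj i j) (hjk : Far j k) (hik : Adj i k) : Meets i x k w := by
  obtain ⟨z, hxz, rfl⟩ := h₁
  obtain ⟨z', hy, hw⟩ := h₂
  simp only [Meets, hij.compl_eq, hij.symm.compl_eq, hjk.compl_eq, hjk.symm.compl_eq,
    hik.compl_eq, hik.symm.compl_eq] at *
  exact cube_threeThree_outer len_mul (len_gen i) (len_gen j) (len_gen k) hij.braid hik.braid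
    hjk.comm (K.adj hik) (K.adj hij) (K.far hjk) hx hxz hy hw

theorem Meets.trans_of_adj_four {N : ℕ} (K : AllBelow n N) {i j k : Fin n}
    {x y w : ArtinTitsB n} (hx : len x ≤ N) (h₁ : Meets i x j y) (h₂ : Meets j y k w)
    (hij : Adj i j) (hjk : Four j k) (hik : Far i k) : Meets i x k w := by
  obtain ⟨z, hxz, rfl⟩ := h₁
  obtain ⟨z', hy, hw⟩ := h₂
  simp only [Meets, hij.compl_eq, hij.symm.compl_eq, hjk.compl_eq, hjk.symm.compl_eq,
    hik.compl_eq, hik.symm.compl_eq] at *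
  exact cube_threeFour_middle len_mul (len_gen i) (len_gen j) (len_gen k) hij.braid hjk.braid
    hik.comm (K.cancel j) (K.cancel k) (K.far hik) (K.adj hij) (K.four hjk) hx hxz hy hw

theorem Meets.trans_of_adj_far_four {N : ℕ} (K : AllBelow n N) {i j k : Fin n}
    {x y w : ArtinTitsB n} (hx : len x ≤ N) (h₁ : Meets i x j y) (h₂ : Meets j y k w)
    (hij : Adj i j) (hjk : Far j k) (hik : Four i k) : Meets i x k w := by
  obtain ⟨z, hxz, rfl⟩ := h₁
  obtain ⟨z', hy, hw⟩ := h₂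
  simp only [Meets, hij.compl_eq, hij.symm.compl_eq, hjk.compl_eq, hjk.symm.compl_eq,
    hik.compl_eq, hik.symm.compl_eq] at *
  exact cube_threeFour_short len_mul (len_gen j) (len_gen i) (len_gen k) hij.symm.braid hik.braid
    hjk.comm (K.far hjk) (K.adj hij.symm) (K.four hik) hx hxz hy hw

theorem Meets.trans_of_far_four_adj {N : ℕ} (K : AllBelow n N) {i j k : Fin n}
    {x y w : ArtinTitsB n} (hx : len x ≤ N) (h₁ : Meets i x j y) (h₂ : Meets j y k w)
    (hij : Far i j) (hjk : Four j k) (hik : Adj i k) : Meets i x k w := by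
  obtain ⟨z, hxz, rfl⟩ := h₁
  obtain ⟨z', hy, hw⟩ := h₂
  simp only [Meets, hij.compl_eq, hij.symm.compl_eq, hjk.compl_eq, hjk.symm.compl_eq,
    hik.compl_eq, hik.symm.compl_eq] at *
  exact cube_threeFour_long len_mul (len_gen i) (len_gen k) (len_gen j) hik.braid hjk.symm.braid
    hij.comm (K.cancel k) (K.far hij) (K.adj hik) (K.four hjk.symm) hx hxz hy hw

theorem Meets.len_eq {i j : Fin n} {x y : ArtinTitsB n} (h : Meets i x j y) : len x = len y := by
  simpa using congrArg len h.eq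

/-- `K` covers lengths below `N`, while `x` may have length exactly `N`: this is the inductive gain.
Reversing the chain with `Meets.symm` halves the number of configurations. -/
theorem Meets.trans {N : ℕ} (K : AllBelow n N) {i j k : Fin n}
    {x y w : ArtinTitsB n} (hx : len x ≤ N) (h₁ : Meets i x j y) (h₂ : Meets j y k w) :
    Meets i x k w := by
  have hw : len w ≤ N := by rwa [← h₂.len_eq, ← h₁.len_eq]
  by_cases hij' : i = j
  · subst hij'
    rwa [meets_self.1 h₁]
  by_cases hjk' : j = k
  · subst hjk'
    rwa [← meets_self.1 h₂]
  -- Both equalities now involve the same pair, and cancelling the common complement in `y`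
  -- identifies the two multipliers.
  by_cases hik' : i = k
  · subst hik'
    obtain ⟨z, rfl, rfl⟩ := h₁
    obtain ⟨z', hy, rfl⟩ := h₂
    rw [meets_self, K.compl_cancel _ hy]
    rwa [len_compl, ← len_mul]
  have hij := (eq_or_far_or_adj_or_four i j).resolve_left hij'
  have hjk := (eq_or_far_or_adj_or_four j k).resolve_left hjk'
  have hik := (eq_or_far_or_adj_or_four i k).resolve_left hik'
  -- The Coxeter graph is a path with a single edge labelled 4: it has no triangle, and two distinct
  -- edges are never both labelled 4.
  have aaa : ¬ (Adj i j ∧ Adj j k ∧ Adj i k) := by simp only [Adj]; omega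
  have ff₁ : ¬ (Four i j ∧ Four j k) := by simp only [Four, Fin.ext_iff] at *; omega
  have ff₂ : ¬ (Four i j ∧ Four i k) := by simp only [Four, Fin.ext_iff] at *; omega
  have ff₃ : ¬ (Four j k ∧ Four i k) := by simp only [Four, Fin.ext_iff] at *; omega
  have aaf₁ : ¬ (Adj i j ∧ Adj j k ∧ Four i k) := by simp only [Adj, Four]; omega
  have aaf₂ : ¬ (Adj i j ∧ Four j k ∧ Adj i k) := by simp only [Adj, Four]; omega
  have aaf₃ : ¬ (Four i j ∧ Adj j k ∧ Adj i k) := by simp only [Adj, Four]; omega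
  by_cases fij : Far i j
  · by_cases fjk : Far j k
    · exact h₁.trans_of_far_far K hx h₂ fij fjk
    by_cases fik : Far i k
    · exact (h₂.symm.trans_of_far_of_far K hw h₁.symm (Ne.symm hjk') fij.symm fik.symm).symm
    rcases hjk.resolve_left fjk with ajk | ajk
    · rcases hik.resolve_left fik with aik | aik
      · exact (h₂.symm.trans_of_adj_far_adj K hw h₁.symm ajk.symm fij.symm aik.symm).symm
      · exact (h₂.symm.trans_of_adj_far_four K hw h₁.symm ajk.symm fij.symm aik.symm).symm
    · rcases hik.resolve_left fik with aik | aik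
      · exact h₁.trans_of_far_four_adj K hx h₂ fij ajk aik
      · exact absurd ⟨ajk, aik⟩ ff₃
  by_cases fjk : Far j k
  · by_cases fik : Far i k
    · exact h₁.trans_of_far_of_far K hx h₂ hij' fjk fik
    rcases hij.resolve_left fij with aij | aij
    · rcases hik.resolve_left fik with aik | aik
      · exact h₁.trans_of_adj_far_adj K hx h₂ aij fjk aik
      · exact h₁.trans_of_adj_far_four K hx h₂ aij fjk aik
    · rcases hik.resolve_left fik with aik | aik
      · exact (h₂.symm.trans_of_far_four_adj K hw h₁.symm fjk.symm aij.symm aik.symm).symm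
      · exact absurd ⟨aij, aik⟩ ff₂
  replace hij := hij.resolve_left fij
  replace hjk := hjk.resolve_left fjk
  by_cases fik : Far i k
  · rcases hij with aij | aij <;> rcases hjk with ajk | ajk
    · exact h₁.trans_of_adj_adj K hx h₂ aij ajk fik
    · exact h₁.trans_of_adj_four K hx h₂ aij ajk fik
    · exact (h₂.symm.trans_of_adj_four K hw h₁.symm ajk.symm aij.symm fik.symm).symm
    · exact absurd ⟨aij, ajk⟩ ff₁
  · rcases hik.resolve_left fik with aik | aik <;> rcases hij with aij | aij <;>
      rcases hjk with ajk | ajk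
    · exact absurd ⟨aij, ajk, aik⟩ aaa
    · exact absurd ⟨aij, ajk, aik⟩ aaf₂
    · exact absurd ⟨aij, ajk, aik⟩ aaf₃
    · exact absurd ⟨aij, ajk⟩ ff₁
    · exact absurd ⟨aij, ajk, aik⟩ aaf₁
    · exact absurd ⟨ajk, aik⟩ ff₃
    · exact absurd ⟨aij, aik⟩ ff₂
    · exact absurd ⟨aij, ajk⟩ ff₁

/-! ### Garside's lemma, by induction on derivations between words. -/

theorem _root_.FreeMonoid.of_mul_inj {α : Type*} {i j : α} {u v : FreeMonoid α}
    (h : FreeMonoid.of i * u = FreeMonoid.of j * v) : i = j ∧ u = v :=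
  List.cons.inj h

theorem _root_.FreeMonoid.eq_one_or_eq_of_mul {α : Type*} (u : FreeMonoid α) :
    u = 1 ∨ ∃ i v, u = FreeMonoid.of i * v := by
  induction u using FreeMonoid.recOn with
  | one => exact .inl rfl
  | of_mul x xs _ => exact .inr ⟨x, xs, rfl⟩

theorem length_eq_of_rel {u v : FreeMonoid (Fin n)} (h : ConGen.Rel (ArtinTitsBRel n) u v) :
    u.length = v.length := by
  simpa using congrArg len (PresentedMonoid.mk_eq_mk_iff.2 h)

/-- A defining relation is the multiple by `1` of itself, and in a product only the first nonempty
factor touches the leading letters. The essential case is transitivity. -/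
theorem meets_of_rel {N : ℕ} (K : AllBelow n N) {u v : FreeMonoid (Fin n)}
    (h : ConGen.Rel (ArtinTitsBRel n) u v) :
    ∀ i u' j v', u = .of i * u' → v = .of j * v' → u'.length ≤ N →
      Meets i (PresentedMonoid.mk _ u') j (PresentedMonoid.mk _ v') := by
  induction h with
  | of u v h =>
    rintro i u' j v' hu hv -
    cases h with
    | comm i' j' h =>
      obtain ⟨rfl, rfl⟩ := FreeMonoid.of_mul_inj hu
      obtain ⟨rfl, rfl⟩ := FreeMonoid.of_mul_inj hv
      have h : Far i' j' := .inl h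
      refine ⟨1, ?_, ?_⟩
      · rw [h.compl_eq, mul_one]; rfl
      · rw [h.symm.compl_eq, mul_one]; rfl
    | braid i' j' h h' =>
      rw [mul_assoc] at hu hv
      obtain ⟨rfl, rfl⟩ := FreeMonoid.of_mul_inj hu
      obtain ⟨rfl, rfl⟩ := FreeMonoid.of_mul_inj hv
      have h : Adj i' j' := .inl ⟨h, h'⟩
      refine ⟨1, ?_, ?_⟩
      · rw [h.compl_eq, mul_one]; rfl
      · rw [h.symm.compl_eq, mul_one]; rfl
    | four i' j' h h' =>
      rw [mul_assoc, mul_assoc] at hu hv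
      obtain ⟨rfl, rfl⟩ := FreeMonoid.of_mul_inj hu
      obtain ⟨rfl, rfl⟩ := FreeMonoid.of_mul_inj hv
      have h : Four i' j' := .inl ⟨h, h'⟩
      refine ⟨1, ?_, ?_⟩
      · rw [h.compl_eq, mul_one, mul_assoc]; rfl
      · rw [h.symm.compl_eq, mul_one, mul_assoc]; rfl
  | refl u =>
    rintro i u' j v' rfl hv -
    obtain ⟨rfl, rfl⟩ := FreeMonoid.of_mul_inj hv
    exact meets_self.2 rfl
  | symm h ih =>
    intro i u' j v' hu hv hN
    refine (ih j v' i u' hv hu ?_).symm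
    have := length_eq_of_rel h
    rw [hu, hv, FreeMonoid.length_mul, FreeMonoid.length_mul, FreeMonoid.length_of,
      FreeMonoid.length_of] at this
    omega
  | @trans u v w h₁ h₂ ih₁ ih₂ =>
    intro i u' j w' hu hw hN
    have h := length_eq_of_rel h₁
    rcases v.eq_one_or_eq_of_mul with rfl | ⟨k, v', rfl⟩
    · simp [hu] at h
    · have hN' : v'.length ≤ N := by
        simp [hu] at h; omega
      exact (ih₁ i u' k v' hu rfl hN).trans K (by rwa [len_mk]) (ih₂ k v' j w' rfl hw hN')
  | @mul u₁ v₁ u₂ v₂ h₁ h₂ ih₁ ih₂ =>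
    intro i u' j v' hu hv hN
    have h := length_eq_of_rel h₁
    rcases u₁.eq_one_or_eq_of_mul with rfl | ⟨i', u₁', rfl⟩
    · obtain rfl : v₁ = 1 := by
        rcases v₁.eq_one_or_eq_of_mul with h' | ⟨i', u₁', rfl⟩
        · exact h'
        · simp at h; omega
      exact ih₂ i u' j v' (by rw [← hu, one_mul]) (by rw [← hv, one_mul]) hN
    · rcases v₁.eq_one_or_eq_of_mul with rfl | ⟨j', v₁', rfl⟩
      · simp at h
      rw [mul_assoc] at hu hv
      obtain ⟨rfl, rfl⟩ := FreeMonoid.of_mul_inj hu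
      obtain ⟨rfl, rfl⟩ := FreeMonoid.of_mul_inj hv
      obtain ⟨z, hz, hz'⟩ := ih₁ _ _ _ _ rfl rfl (by simp at hN; omega)
      have e := PresentedMonoid.mk_eq_mk_iff.2 h₂
      exact ⟨z * PresentedMonoid.mk _ u₂, by rw [map_mul, hz, mul_assoc],
        by rw [map_mul, hz', e, mul_assoc]⟩

theorem allBelow (n N : ℕ) : AllBelow n N := by
  induction N with
  | zero => exact fun i j x y hx => absurd hx (Nat.not_lt_zero _)
  | succ N K =>
    intro i j x y hx h
    obtain ⟨u, rfl⟩ := PresentedMonoid.surjective_mk x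
    obtain ⟨v, rfl⟩ := PresentedMonoid.surjective_mk y
    refine meets_of_rel K (PresentedMonoid.mk_eq_mk_iff.1 ?_ : ConGen.Rel _ (.of i * u) (.of j * v))
      i u j v rfl rfl (by rw [len_mk] at hx; omega)
    rw [map_mul, map_mul]; exact h

/-- In the Artin–Tits monoid, all equalities `gen i * x = gen j * y` come from the relations. -/
theorem meets_of_eq {i j : Fin n} {x y : ArtinTitsB n} (h : gen i * x = gen j * y) :
    Meets i x j y :=
  allBelow n _ i j x y (Nat.lt_succ_self _) h

theorem gen_mul_cancel {i : Fin n} {x y : ArtinTitsB n} (h : gen i * x = gen i * y) : x = y :=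
  meets_self.1 (meets_of_eq h)

/-! ### Cancellation, atoms and finiteness of spheres. -/

@[elab_as_elim]
theorem gen_induction {P : ArtinTitsB n → Prop} (one : P 1)
    (gen_mul : ∀ i x, P x → P (gen i * x)) (x : ArtinTitsB n) : P x := by
  obtain ⟨u, rfl⟩ := PresentedMonoid.surjective_mk x
  induction u using FreeMonoid.recOn with
  | one => exact one
  | of_mul i xs h => rw [map_mul]; exact gen_mul i _ h

theorem mul_cancel_left {d x y : ArtinTitsB n} (h : d * x = d * y) : x = y := by
  induction d using gen_induction with
  | one => simpa using h
  | gen_mul i d ih => exact ih (gen_mul_cancel (by simpa only [mul_assoc] using h))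

theorem eq_one_of_len_eq_zero {x : ArtinTitsB n} (h : len x = 0) : x = 1 := by
  induction x using gen_induction with
  | one => rfl
  | gen_mul i x _ => simp at h

theorem eq_one_iff {x : ArtinTitsB n} : x = 1 ↔ ∀ i, ¬ gen i ∣ x := by
  constructor
  · rintro rfl i ⟨y, hy⟩
    have := congrArg len hy
    simp at this; omega
  · intro h
    induction x using gen_induction with
    | one => rfl
    | gen_mul i x _ => exact absurd (Dvd.intro _ rfl) (h i)

theorem monoidAtoms_eq : monoidAtoms (ArtinTitsB n) = Set.range gen := by
  ext a
  constructor
  · rintro ⟨h1, h⟩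
    induction a using gen_induction with
    | one => exact absurd rfl h1
    | gen_mul i x _ =>
      rcases h _ _ rfl with h | h
      · simpa using congrArg len h
      · exact ⟨i, by rw [h, mul_one]⟩
  · rintro ⟨i, rfl⟩
    refine ⟨fun h => by simpa using congrArg len h, fun b c h => ?_⟩
    have h := congrArg len h
    rw [len_gen, len_mul] at h
    rcases Nat.eq_zero_or_pos (len b) with hb | hb
    · exact .inl (eq_one_of_len_eq_zero hb)
    · exact .inr (eq_one_of_len_eq_zero (by omega))

/-- The relations are homogeneous and the atoms are the generators, so all atom words for an element
have the same length. -/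
theorem hasAtomWord_iff {x : ArtinTitsB n} {k : ℕ} : HasAtomWord x k ↔ len x = k := by
  constructor
  · rintro ⟨w, hw, rfl, rfl⟩
    induction w with
    | nil => simp
    | cons a w ih =>
      rw [monoidAtoms_eq] at hw ih
      obtain ⟨i, rfl⟩ := hw a (by simp)
      rw [List.prod_cons, len_mul, len_gen, ih (fun x hx => hw x (by simp [hx])), List.length_cons,
        add_comm]
  · rintro rfl
    induction x using gen_induction with
    | one => exact ⟨[], by simp⟩
    | gen_mul i x ih =>
      obtain ⟨w, hw, rfl, h⟩ := ih
      refine ⟨gen i :: w, ?_, by simp, by simp [h, add_comm]⟩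
      intro y hy
      rcases List.mem_cons.1 hy with rfl | hy
      · rw [monoidAtoms_eq]; exact ⟨i, rfl⟩
      · exact hw y hy

theorem atomSphere_eq (k : ℕ) : atomSphere (ArtinTitsB n) k = {x | len x = k} := by
  ext x
  simp only [atomSphere, hasAtomWord_iff, Set.mem_ofPred_eq]
  exact ⟨fun h => h.1, fun h => ⟨h, fun l hl => by simp_all⟩⟩

theorem finite_len_eq (n k : ℕ) : {x : ArtinTitsB n | len x = k}.Finite := by
  induction k with
  | zero => exact (Set.finite_singleton 1).subset fun x hx => eq_one_of_len_eq_zero hx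
  | succ k ih =>
    refine (Set.finite_iUnion fun i : Fin n => ih.image (gen i * ·)).subset fun x hx => ?_
    induction x using gen_induction with
    | one => simp at hx
    | gen_mul i x _ =>
      refine Set.mem_iUnion.2 ⟨i, x, ?_, rfl⟩
      simp at hx ⊢; omega

/-! ### Independence and least common multiples of sets of generators. -/

/-- The generator of index `i`, for a natural number `i`; equal to `1` if `n ≤ i`. -/
def letter (n i : ℕ) : ArtinTitsB n := if h : i < n then gen ⟨i, h⟩ else 1

theorem letter_eq_gen (i : Fin n) : letter n i = gen i := dif_pos i.2

theorem letter_of_lt {i : ℕ} (h : i < n) : letter n i = gen ⟨i, h⟩ := dif_pos h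

theorem letter_mul_cancel {i : ℕ} {x y : ArtinTitsB n}
    (h : letter n i * x = letter n i * y) : x = y :=
  mul_cancel_left h

theorem len_letter {i : ℕ} (h : i < n) : len (letter n i) = 1 := by
  rw [letter_of_lt h, len_gen]

theorem letter_braid {i : ℕ} (h : i + 2 < n) :
    letter n i * letter n (i + 1) * letter n i =
      letter n (i + 1) * letter n i * letter n (i + 1) := by
  rw [letter_of_lt (by omega : i < n), letter_of_lt (by omega : i + 1 < n)]
  exact Adj.braid (.inl ⟨rfl, by simp; omega⟩)

theorem letter_braid_four {i : ℕ} (h : i + 2 = n) :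
    letter n i * letter n (i + 1) * letter n i * letter n (i + 1) =
      letter n (i + 1) * letter n i * letter n (i + 1) * letter n i := by
  rw [letter_of_lt (by omega : i < n), letter_of_lt (by omega : i + 1 < n)]
  exact Four.braid (.inl ⟨rfl, by simp; omega⟩)

theorem letter_dvd_letter_succ_mul {i : ℕ} (h : i + 2 < n) {y : ArtinTitsB n}
    (hy : letter n i ∣ letter n (i + 1) * y) :
    ∃ z, y = letter n i * (letter n (i + 1) * z) := by
  rw [letter_of_lt (by omega : i < n), letter_of_lt (by omega : i + 1 < n)] at *
  obtain ⟨x, hx⟩ := hy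
  obtain ⟨z, hz, -⟩ := meets_of_eq hx
  rw [Adj.compl_eq (.inr ⟨rfl, by simp; omega⟩), mul_assoc] at hz
  exact ⟨z, hz⟩

theorem letter_dvd_letter_succ_mul_four {i : ℕ} (h : i + 2 = n) {y : ArtinTitsB n}
    (hy : letter n i ∣ letter n (i + 1) * y) :
    letter n i * letter n (i + 1) * letter n i ∣ y := by
  rw [letter_of_lt (by omega : i < n), letter_of_lt (by omega : i + 1 < n)] at *
  obtain ⟨x, hx⟩ := hy
  obtain ⟨z, hz, -⟩ := meets_of_eq hx
  rw [Four.compl_eq (.inr ⟨rfl, by simp; omega⟩)] at hz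
  exact ⟨z, hz⟩

/-- The element `u` commutes with the `i`-th generator, and is "coprime" to it. -/
def Indep (i : ℕ) (u : ArtinTitsB n) : Prop :=
  Commute (letter n i) u ∧ ∀ x, letter n i ∣ u * x → letter n i ∣ x

theorem indep_one (i : ℕ) : Indep i (1 : ArtinTitsB n) := ⟨Commute.one_right _, by simp⟩

theorem Indep.mul {i : ℕ} {u v : ArtinTitsB n} (hu : Indep i u) (hv : Indep i v) :
    Indep i (u * v) :=
  ⟨hu.1.mul_right hv.1, fun x h => hv.2 _ (hu.2 _ (by rwa [← mul_assoc]))⟩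

theorem Indep.exists_eq {i : ℕ} {u x y : ArtinTitsB n} (hu : Indep i u)
    (h : u * x = letter n i * y) : ∃ z, x = letter n i * z ∧ y = u * z := by
  obtain ⟨z, rfl⟩ := hu.2 x (Dvd.intro _ h.symm)
  refine ⟨z, rfl, letter_mul_cancel (i := i) ?_⟩
  rw [← h, ← mul_assoc, ← mul_assoc, hu.1.eq]

theorem indep_letter {i j : ℕ} (hi : i < n) (h : j + 1 < i ∨ i + 1 < j) :
    Indep i (letter n j) := by
  by_cases hj : j < n
  · rw [Indep, letter_of_lt hi, letter_of_lt hj]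
    have hij : Far (⟨i, hi⟩ : Fin n) ⟨j, hj⟩ := h.symm
    refine ⟨hij.comm, ?_⟩
    rintro x ⟨y, hy⟩
    obtain ⟨z, hz, -⟩ := meets_of_eq hy
    rw [hij.symm.compl_eq] at hz
    exact ⟨z, hz⟩
  · rw [letter, dif_neg hj]
    exact indep_one i

/-- The element `d` is the least common right multiple of the generators with index in `T`. -/
structure IsLcm (d : ArtinTitsB n) (T : Set ℕ) : Prop where
  indep : ∀ j < n, (∀ t ∈ T, t + 1 < j ∨ j + 1 < t) → Indep j d
  dvd_iff : ∀ x, d ∣ x ↔ ∀ t ∈ T, letter n t ∣ x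

theorem isLcm_one : IsLcm (1 : ArtinTitsB n) ∅ := ⟨fun _ _ _ => indep_one _, by simp⟩

/-- With no edge between `T` and `U`, each letter of `U` commutes with `d` and passes through it in
divisibility; this is what the field `indep` is carried for. -/
theorem IsLcm.union {d e : ArtinTitsB n} {T U : Set ℕ} (hd : IsLcm d T) (he : IsLcm e U)
    (hU : ∀ u ∈ U, u < n) (h : ∀ t ∈ T, ∀ u ∈ U, t + 1 < u ∨ u + 1 < t) :
    IsLcm (d * e) (T ∪ U) where
  indep j hj hTU :=
    (hd.indep j hj fun t ht => hTU t (.inl ht)).mul (he.indep j hj fun t ht => hTU t (.inr ht))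
  dvd_iff x := by
    have hdU (u) (hu : u ∈ U) : Indep u d := hd.indep u (hU u hu) fun t ht => h t ht u hu
    constructor
    · rintro ⟨y, rfl⟩ t (ht | ht)
      · rw [mul_assoc]
        exact (hd.dvd_iff _).1 (Dvd.intro _ rfl) t ht
      · obtain ⟨z, hz⟩ := (he.dvd_iff _).1 (Dvd.intro y rfl) t ht
        refine ⟨d * z, ?_⟩
        rw [mul_assoc, hz, ← mul_assoc, ← mul_assoc, (hdU t ht).1.eq]
    · intro hx
      obtain ⟨y, rfl⟩ := (hd.dvd_iff x).2 fun t ht => hx t (.inl ht)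
      exact mul_dvd_mul_left d ((he.dvd_iff y).2 fun u hu => (hdU u hu).2 y (hx u (.inr hu)))

/-! ### Garside elements of intervals, of type A and then of type B. -/

/-- A family of words by which the Garside elements of the intervals ending in `k` are built. -/
structure IsChain (k : ℕ) (W : ℕ → ℕ → ArtinTitsB n) : Prop where
  zero : ∀ i, W i 0 = 1
  indep : ∀ i l, i + l = k → ∀ j < n, (∀ t ∈ Set.Ico i (i + l), t + 1 < j ∨ j + 1 < t) →
    Indep j (W i l)
  -- With `dvd'`, this says that `W i (l + 1)` is the right complement of `W (i + 1) l` by the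
  -- `i`-th letter.
  dvd : ∀ i l, i + l + 1 = k → ∀ q, letter n i ∣ W (i + 1) l * q → W i (l + 1) ∣ q
  dvd' : ∀ i l, i + l + 1 = k → letter n i ∣ W (i + 1) l * W i (l + 1)

/-- The product of the words `W j _` for `i ≤ j < i + l`, in decreasing order of `j`. -/
def chainProd (W : ℕ → ℕ → ArtinTitsB n) : ℕ → ℕ → ArtinTitsB n
  | _, 0 => 1
  | i, l + 1 => chainProd W (i + 1) l * W i (l + 1)

theorem IsChain.indep_chainProd {k : ℕ} {W : ℕ → ℕ → ArtinTitsB n} (hW : IsChain k W)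
    {i l j : ℕ} (hil : i + l = k) (hj : j < n)
    (h : ∀ t ∈ Set.Ico i (i + l), t + 1 < j ∨ j + 1 < t) : Indep j (chainProd W i l) := by
  induction l generalizing i with
  | zero => exact indep_one j
  | succ l ih =>
    refine (ih (by omega) fun t ht => h t ?_).mul (hW.indep i (l + 1) hil j hj h)
    simp only [Set.mem_Ico] at *; omega

/-- Adding the letter `i` to the interval multiplies its lcm by the complement. The last factor `W
(i + 1) l` alone determines that complement, since the earlier factors `V` only involve letters from
`i + 2` on. -/
theorem IsChain.isLcm {k : ℕ} {W : ℕ → ℕ → ArtinTitsB n} (hW : IsChain k W) (hk : k ≤ n)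
    (i l : ℕ) (hil : i + l = k) : IsLcm (chainProd W i l) (Set.Ico i (i + l)) := by
  induction l generalizing i with
  | zero => simpa [chainProd] using isLcm_one
  | succ l ih =>
    have ih := ih (i + 1) (by omega)
    have hV : ∃ V, chainProd W (i + 1) l = V * W (i + 1) l ∧ Indep i V := by
      cases l with
      | zero => exact ⟨1, by rw [hW.zero]; rfl, indep_one i⟩
      | succ l =>
        exact ⟨chainProd W (i + 1 + 1) l, rfl, hW.indep_chainProd (by omega) (by omega)
          (by simp only [Set.mem_Ico]; omega)⟩
    obtain ⟨V, hV, hVi⟩ := hV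
    have hIco (P : ℕ → Prop) : (∀ t ∈ Set.Ico i (i + (l + 1)), P t) ↔
        P i ∧ ∀ t ∈ Set.Ico (i + 1) (i + 1 + l), P t := by
      simp only [Set.mem_Ico]
      constructor
      · exact fun h => ⟨h i (by omega), fun t ht => h t (by omega)⟩
      · rintro ⟨h, h'⟩ t ht
        rcases ht.1.eq_or_lt with rfl | h''
        · exact h
        · exact h' t (by omega)
    refine ⟨fun j hj h => hW.indep_chainProd hil hj h, fun x => ?_⟩
    rw [hIco, ← ih.dvd_iff, chainProd]
    constructor
    · rintro ⟨y, rfl⟩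
      refine ⟨?_, ⟨_, mul_assoc ..⟩⟩
      obtain ⟨z, hz⟩ := hW.dvd' i l (by omega)
      rw [hV, mul_assoc V, hz, ← mul_assoc, ← hVi.1.eq, mul_assoc, mul_assoc]
      exact Dvd.intro _ rfl
    · rintro ⟨h, y, rfl⟩
      rw [hV, mul_assoc] at h
      exact mul_dvd_mul_left _ (hW.dvd i l (by omega) y (hVi.2 _ h))

/-- The word `a_i a_{i+1} ⋯ a_{i+l-1}`. -/
def ascent (n : ℕ) : ℕ → ℕ → ArtinTitsB n
  | _, 0 => 1
  | i, l + 1 => letter n i * ascent n (i + 1) l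

theorem len_ascent (i l : ℕ) (h : i + l ≤ n) : len (ascent n i l) = l := by
  induction l generalizing i with
  | zero => simp [ascent]
  | succ l ih => rw [ascent, len_mul, ih _ (by omega), len_letter (by omega), add_comm]

theorem indep_ascent {i l j : ℕ} (hj : j < n)
    (h : ∀ t ∈ Set.Ico i (i + l), t + 1 < j ∨ j + 1 < t) : Indep j (ascent n i l) := by
  induction l generalizing i with
  | zero => exact indep_one j
  | succ l ih =>
    refine (indep_letter hj (h i ?_)).mul (ih fun t ht => h t ?_)
    all_goals simp only [Set.mem_Ico] at *; omega

/-- As `k < n`, the last generator is avoided and only length three braid relations occur. -/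
theorem isChain_ascent {k : ℕ} (hk : k < n) : IsChain k (ascent n) where
  zero _ := rfl
  indep i l _ j hj h := indep_ascent hj h
  dvd i l hil q hq := by
    induction l generalizing i q with
    | zero => simpa [ascent] using hq
    | succ l ih =>
      rw [ascent, mul_assoc] at hq
      obtain ⟨z, hz⟩ := letter_dvd_letter_succ_mul (by omega) hq
      obtain ⟨q', rfl, hq'⟩ := (indep_ascent (n := n) (i := i + 1 + 1) (l := l) (j := i) (by omega)
        (by simp only [Set.mem_Ico]; omega)).exists_eq hz
      rw [ascent]
      exact mul_dvd_mul_left _ (ih (i + 1) (by omega) q' (Dvd.intro _ hq'))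
  dvd' i l hil := by
    induction l generalizing i with
    | zero => simp [ascent]
    | succ l ih =>
      obtain ⟨s, hs⟩ := ih (i + 1) (by omega)
      have h := (indep_ascent (n := n) (i := i + 1 + 1) (l := l) (j := i) (by omega)
        (by simp only [Set.mem_Ico]; omega)).1.eq
      refine ⟨letter n (i + 1) * (letter n i * s), ?_⟩
      calc ascent n (i + 1) (l + 1) * ascent n i (l + 1 + 1)
          = letter n (i + 1) * (ascent n (i + 1 + 1) l * letter n i) *
            ascent n (i + 1) (l + 1) := by
              rw [ascent.eq_2 n i (l + 1), ascent.eq_2 n (i + 1) l]; simp only [mul_assoc]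
        _ = letter n (i + 1) * letter n i *
            (ascent n (i + 1 + 1) l * ascent n (i + 1) (l + 1)) := by
              rw [← h]; simp only [mul_assoc]
        _ = (letter n (i + 1) * letter n i * letter n (i + 1)) * s := by
              rw [hs]; simp only [mul_assoc]
        _ = _ := by rw [← letter_braid (by omega)]; simp only [mul_assoc]

/-- The word `a_i ⋯ a_{i+l-2} a_{i+l-1} a_{i+l-2} ⋯ a_i`. -/
def palindrome (n : ℕ) : ℕ → ℕ → ArtinTitsB n
  | _, 0 => 1
  | i, 1 => letter n i
  | i, l + 2 => letter n i * palindrome n (i + 1) (l + 1) * letter n i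

theorem len_palindrome (i l : ℕ) (h : i + l + 1 ≤ n) :
    len (palindrome n i (l + 1)) = 2 * l + 1 := by
  induction l generalizing i with
  | zero => rw [palindrome, len_letter (by omega)]
  | succ l ih =>
    rw [palindrome, len_mul, len_mul, ih _ (by omega), len_letter (by omega)]
    ring

theorem indep_palindrome {i l j : ℕ} (hj : j < n)
    (h : ∀ t ∈ Set.Ico i (i + l), t + 1 < j ∨ j + 1 < t) : Indep j (palindrome n i l) := by
  induction l generalizing i with
  | zero => exact indep_one j
  | succ l ih =>
    have hi : Indep j (letter n i) := indep_letter hj (h i (by simp))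
    cases l with
    | zero => exact hi
    | succ l =>
      refine (hi.mul (ih fun t ht => h t ?_)).mul hi
      simp only [Set.mem_Ico] at *; omega

/-- The length four relation enters only for the interval of the last two generators; longer
intervals reduce to it by length three braids. -/
theorem isChain_palindrome : IsChain n (palindrome n) where
  zero _ := rfl
  indep i l _ j hj h := indep_palindrome hj h
  dvd i l hil q hq := by
    induction l generalizing i q with
    | zero => simpa [palindrome] using hq
    | succ l ih =>
      cases l with
      | zero => exact letter_dvd_letter_succ_mul_four (by omega) hq
      | succ l =>
        have hV : Indep i (palindrome n (i + 1 + 1) (l + 1)) :=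
          indep_palindrome (by omega) (by simp only [Set.mem_Ico]; omega)
        replace ih := ih (i + 1) (by omega)
        simp only [palindrome] at ih hq ⊢
        generalize palindrome n (i + 1 + 1) (l + 1) = V at *
        -- With `a`, `b` the letters `i`, `i + 1`, the hypothesis is `a ∣ b * V * b * q`. Pushing
        -- `a` through yields `q = a * b * s`; the induction hypothesis, pushed through `V` in turn,
        -- yields `s = V * b * a * r`.
        simp only [mul_assoc] at hq
        obtain ⟨z, hz⟩ := letter_dvd_letter_succ_mul (by omega) hq
        obtain ⟨q', hq', hqz⟩ := hV.exists_eq hz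
        obtain ⟨s, rfl⟩ := letter_dvd_letter_succ_mul (by omega) (Dvd.intro _ hq'.symm)
        have hq'' : q' = letter n (i + 1) * (letter n i * s) := by
          refine letter_mul_cancel (i := i) ?_
          rw [← hq']
          simpa only [mul_assoc] using congrArg (· * s) (letter_braid (n := n) (i := i) (by omega)).symm
        obtain ⟨s', hs'⟩ := ih q' (Dvd.intro _ hqz)
        rw [hq''] at hs'
        simp only [mul_assoc] at hs'
        obtain ⟨r', hr', hs⟩ := hV.exists_eq (letter_mul_cancel hs').symm
        obtain ⟨r, rfl⟩ := letter_dvd_letter_succ_mul (by omega) (Dvd.intro _ hr'.symm)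
        have hr'' : r' = letter n (i + 1) * (letter n i * r) := by
          refine letter_mul_cancel (i := i) ?_
          rw [← hr']
          simpa only [mul_assoc] using congrArg (· * r) (letter_braid (n := n) (i := i) (by omega)).symm
        refine ⟨r, ?_⟩
        rw [hs, hr'']
        simp only [mul_assoc]
  dvd' i l hil := by
    induction l generalizing i with
    | zero => simp [palindrome]
    | succ l ih =>
      cases l with
      | zero =>
        simp only [palindrome]
        rw [← mul_assoc, ← mul_assoc, ← letter_braid_four (by omega)]
        simp only [mul_assoc]
        exact Dvd.intro _ rfl
      | succ l =>
        have hV : Indep i (palindrome n (i + 1 + 1) (l + 1)) :=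
          indep_palindrome (by omega) (by simp only [Set.mem_Ico]; omega)
        obtain ⟨s, hs⟩ := ih (i + 1) (by omega)
        simp only [palindrome] at hs ⊢
        generalize palindrome n (i + 1 + 1) (l + 1) = V at *
        have hc : letter n i * V = V * letter n i := hV.1.eq
        have hb := letter_braid (n := n) (i := i) (by omega)
        generalize letter n i = a at *
        generalize letter n (i + 1) = b at *
        refine ⟨b * a * s * a * b, ?_⟩
        calc b * V * b * (a * (b * V * b) * a) = b * V * (b * a * b) * V * b * a := by
              simp only [mul_assoc]
          _ = b * (V * a) * b * (a * V) * b * a := by rw [← hb]; simp only [mul_assoc]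
          _ = b * a * V * b * V * (a * b * a) := by rw [hc]; nth_rewrite 1 [← hc]; simp only [mul_assoc]
          _ = b * a * (V * (b * V * b)) * a * b := by rw [hb]; simp only [mul_assoc]
          _ = (b * a * b) * s * a * b := by rw [hs]; simp only [mul_assoc]
          _ = _ := by rw [← hb]; simp only [mul_assoc]

/-! ### Generating functions and the determinant recursion. -/

open PowerSeries

/-- The Garside element of the interval `[i, i + l)`. -/
def garside (n i l : ℕ) : ArtinTitsB n :=
  if i + l < n then chainProd (ascent n) i l else chainProd (palindrome n) i l

theorem isLcm_garside (i l : ℕ) (h : i + l ≤ n) : IsLcm (garside n i l) (Set.Ico i (i + l)) := by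
  rw [garside]
  split_ifs with h'
  · exact (isChain_ascent h').isLcm h i l rfl
  · exact isChain_palindrome.isLcm le_rfl i l (by omega)

theorem len_garside_of_lt (i l : ℕ) (h : i + l < n) : len (garside n i l) = (l + 1).choose 2 := by
  rw [garside, if_pos h]
  induction l generalizing i with
  | zero => simp [chainProd]
  | succ l ih =>
    rw [chainProd, len_mul, ih (i + 1) (by omega), len_ascent _ _ (by omega), Nat.choose_succ_succ' (l + 1) 1,
      Nat.choose_one_right, add_comm]

theorem len_garside_of_eq (i l : ℕ) (h : i + l = n) : len (garside n i l) = l ^ 2 := by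
  rw [garside, if_neg (by omega)]
  induction l generalizing i with
  | zero => simp [chainProd]
  | succ l ih =>
    rw [chainProd, len_mul, ih (i + 1) (by omega), len_palindrome _ _ (by omega)]
    ring

/-- The generating function of a set of elements, counted by length. -/
noncomputable def genFun (A : Set (ArtinTitsB n)) : PowerSeries ℤ :=
  PowerSeries.mk fun k => (({x | len x = k} ∩ A).ncard : ℤ)

theorem growthSeries_eq : growthSeries (ArtinTitsB n) = genFun (n := n) Set.univ := by
  simp only [growthSeries, genFun, atomSphere_eq, Set.inter_univ]

theorem genFun_union {A B : Set (ArtinTitsB n)} (h : Disjoint A B) :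
    genFun (A ∪ B) = genFun A + genFun B := by
  ext k
  simp only [genFun, coeff_mk, map_add]
  rw [Set.inter_union_distrib_left, Set.ncard_union_eq
    (h.mono Set.inter_subset_right Set.inter_subset_right)
    ((finite_len_eq n k).subset Set.inter_subset_left)
    ((finite_len_eq n k).subset Set.inter_subset_left), Nat.cast_add]

theorem genFun_one : genFun ({1} : Set (ArtinTitsB n)) = 1 := by
  ext k
  rw [genFun, coeff_mk, coeff_one]
  split_ifs with h
  · rw [Set.inter_eq_right.2 (by simp [h]), Set.ncard_singleton, Nat.cast_one]
  · rw [Set.inter_singleton_eq_empty.2 (by simpa using Ne.symm h), Set.ncard_empty, Nat.cast_zero]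

/-- By left cancellation, multiplication by `d` is a bijection onto its multiples, raising length by
`len d`. -/
theorem genFun_dvd (d : ArtinTitsB n) :
    genFun {x | d ∣ x} = X ^ len d * genFun (n := n) Set.univ := by
  ext k
  rw [genFun, coeff_mk, coeff_X_pow_mul', genFun, coeff_mk]
  split_ifs with h
  · have : {x | len x = k} ∩ {x | d ∣ x} = (d * ·) '' ({x | len x = k - len d} ∩ Set.univ) := by
      ext x
      simp only [Set.mem_inter_iff, Set.mem_ofPred_eq, Set.mem_image, Set.mem_univ, and_true]
      constructor
      · rintro ⟨rfl, y, rfl⟩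
        exact ⟨y, by simp, rfl⟩
      · rintro ⟨y, hy, rfl⟩
        exact ⟨by rw [len_mul]; omega, Dvd.intro _ rfl⟩
    rw [this, Set.ncard_image_of_injective _ fun x y => mul_cancel_left]
  · have : {x | len x = k} ∩ {x | d ∣ x} = ∅ := by
      rw [Set.eq_empty_iff_forall_notMem]
      rintro x ⟨hx, y, rfl⟩
      simp at hx; omega
    rw [this, Set.ncard_empty, Nat.cast_zero]

/-- The matrix of order `m + 1` whose row `0` is read off the Garside elements of intervals whose
length is shifted by `c`, and whose other rows are those of `matrixB m`. -/
noncomputable def shiftedMatrix (c m : ℕ) : Matrix (Fin (m + 1)) (Fin (m + 1)) (Polynomial ℤ) :=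
  (matrixB m).updateRow 0 fun j =>
    if (j : ℕ) = m then Polynomial.X ^ ((m + c) ^ 2)
    else Polynomial.X ^ (((j : ℕ) + 1 + c).choose 2)

theorem shiftedMatrix_zero (m : ℕ) : shiftedMatrix 0 m = matrixB m := by
  ext i j : 2
  refine Fin.cases ?_ (fun i => ?_) i <;> simp [shiftedMatrix, matrixB]

theorem det_shiftedMatrix_zero (c : ℕ) : (shiftedMatrix c 0).det = Polynomial.X ^ (c ^ 2) := by
  simp [shiftedMatrix]

/-- Column `0` vanishes below row `1`, where its entry is `X ^ 0 = 1`. Deleting row `0` closes the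
current interval at length `c`; deleting row `1` keeps it open at length `c + 1`. -/
theorem det_shiftedMatrix_succ (c m : ℕ) :
    (shiftedMatrix c (m + 1)).det =
      Polynomial.X ^ (c + 1).choose 2 * (shiftedMatrix 0 m).det - (shiftedMatrix (c + 1) m).det := by
  rw [Matrix.det_succ_column_zero, Fin.sum_univ_succ, Fin.sum_univ_succ, Finset.sum_eq_zero]
  · have h0 : (shiftedMatrix c (m + 1)).submatrix (Fin.succAbove 0) Fin.succ =
        shiftedMatrix 0 m := by
      rw [shiftedMatrix_zero]
      ext i j : 2
      simp [shiftedMatrix, matrixB, Nat.add_right_comm]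
    have h1 : (shiftedMatrix c (m + 1)).submatrix (Fin.succAbove (Fin.succ 0)) Fin.succ =
        shiftedMatrix (c + 1) m := by
      ext i j : 2
      refine Fin.cases ?_ (fun i => ?_) i
      · simp [shiftedMatrix, matrixB, Nat.add_right_comm, Nat.add_assoc]
      · simp [shiftedMatrix, matrixB]
    rw [h0, h1]
    simp [shiftedMatrix, matrixB, add_comm c 1, sub_eq_add_neg]
  · intro i _
    simp [shiftedMatrix, matrixB]

/-- The elements divisible by the generators with index in `T` or in `[i, i + c)`, and by no
generator with index in `[i + c, n)`. -/
def divisorPattern (T : Set ℕ) (i c : ℕ) : Set (ArtinTitsB n) :=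
  {x | (∀ t ∈ T ∪ Set.Ico i (i + c), letter n t ∣ x) ∧
    ∀ j, i + c ≤ j → j < n → ¬ letter n j ∣ x}

theorem IsLcm.union_garside {d : ArtinTitsB n} {T : Set ℕ} (hd : IsLcm d T) {i c : ℕ}
    (h : i + c ≤ n) (hT : ∀ t ∈ T, t + 1 < i) :
    IsLcm (d * garside n i c) (T ∪ Set.Ico i (i + c)) := by
  refine hd.union (isLcm_garside i c h) (fun u hu => by have := hu.2; omega) fun t ht u hu => ?_
  have := hT t ht
  have := hu.1
  omega

/-- `T` holds the closed intervals, `[i, i + c)` is the open one, and `m` counts the generators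
still to be decided. The recursion on the generator `i + c` is the column expansion of the
determinant. -/
theorem genFun_divisorPattern {m i c : ℕ} (h : i + c + m = n) {d : ArtinTitsB n} {T : Set ℕ}
    (hd : IsLcm d T) (hT : ∀ t ∈ T, t + 1 < i) :
    genFun (n := n) (divisorPattern T i c) =
      X ^ len d * (((shiftedMatrix c m).det : Polynomial ℤ) : PowerSeries ℤ) *
        genFun (n := n) Set.univ := by
  induction m generalizing i c d T with
  | zero =>
    have hL : IsLcm (d * garside n i c) (T ∪ Set.Ico i (i + c)) := hd.union_garside (by omega) hT
    have hS : divisorPattern T i c = {x | d * garside n i c ∣ x} := by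
      ext x
      simp only [divisorPattern, Set.mem_ofPred_eq, hL.dvd_iff]
      exact and_iff_left fun j hj hj' => by omega
    rw [hS, genFun_dvd, len_mul, len_garside_of_eq i c h, det_shiftedMatrix_zero, pow_add]
    push_cast
    rfl
  | succ m ih =>
    have hL : IsLcm (d * garside n i c) (T ∪ Set.Ico i (i + c)) := hd.union_garside (by omega) hT
    have h₁ := ih (i := i + c + 1) (c := 0) (by omega) hL
      (by
        rintro t (ht | ht)
        · have := hT t ht; omega
        · have := ht.2; omega)
    have h₂ := ih (i := i) (c := c + 1) (by omega) hd hT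
    have hIco (P : ℕ → Prop) : (∀ t ∈ T ∪ Set.Ico i (i + c + 1), P t) ↔
        (∀ t ∈ T ∪ Set.Ico i (i + c), P t) ∧ P (i + c) := by
      constructor
      · intro H
        refine ⟨fun t ht => H t (ht.imp_right fun ht => ⟨ht.1, by have := ht.2; omega⟩), H _ (.inr ?_)⟩
        simp
      · rintro ⟨H, H'⟩ t (ht | ht)
        · exact H t (.inl ht)
        · rcases Nat.lt_or_ge t (i + c) with h | h
          · exact H t (.inr ⟨ht.1, h⟩)
          · obtain rfl : t = i + c := by have := ht.2; omega
            exact H'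
    -- Leaving the letter `i + c` unconstrained closes the interval just before it; the next one can
    -- start at `i + c + 1`, so the gap separates it from `T`.
    have hU : divisorPattern (n := n) (T ∪ Set.Ico i (i + c)) (i + c + 1) 0 =
        divisorPattern T i c ∪ divisorPattern T i (c + 1) := by
      ext x
      rw [Set.mem_union]
      simp only [divisorPattern, Set.mem_ofPred_eq, hIco, add_zero, Set.Ico_self,
        Set.union_empty, ← add_assoc]
      constructor
      · rintro ⟨H, H'⟩
        by_cases hx : letter n (i + c) ∣ x
        · exact .inr ⟨⟨H, hx⟩, H'⟩
        · refine .inl ⟨H, fun j hj hj' => ?_⟩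
          rcases hj.eq_or_lt with rfl | hj
          · exact hx
          · exact H' j hj hj'
      · rintro (⟨H, H'⟩ | ⟨⟨H, -⟩, H'⟩)
        · exact ⟨H, fun j hj hj' => H' j (by omega) hj'⟩
        · exact ⟨H, H'⟩
    have hD : Disjoint (divisorPattern (n := n) T i c) (divisorPattern T i (c + 1)) := by
      rw [Set.disjoint_left]
      rintro x ⟨-, hx⟩ ⟨hx', -⟩
      exact hx (i + c) le_rfl (by omega) ((hIco _).1 hx').2
    rw [hU, genFun_union hD, h₂, len_mul, len_garside_of_lt i c (by omega)] at h₁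
    rw [eq_sub_of_add_eq h₁, det_shiftedMatrix_succ, pow_add]
    push_cast
    ring

theorem growthSeries_mul_det (n : ℕ) :
    growthSeries (ArtinTitsB n) * ((matrixB n).det : PowerSeries ℤ) = 1 := by
  -- With nothing required and every generator forbidden, the pattern reduces to `{1}`.
  have h := genFun_divisorPattern (n := n) (m := n) (i := 0) (c := 0) (by omega) isLcm_one (by simp)
  have h1 : divisorPattern (n := n) ∅ 0 0 = {1} := by
    ext x
    rw [Set.mem_singleton_iff, eq_one_iff]
    simp only [divisorPattern, add_zero, Set.Ico_self, Set.union_empty, Set.mem_ofPred_eq]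
    constructor
    · rintro ⟨-, h⟩ i
      rw [← letter_eq_gen]
      exact h i (Nat.zero_le _) i.2
    · intro h
      refine ⟨by simp, fun j _ hj => ?_⟩
      rw [letter_of_lt hj]
      exact h _
  rw [h1, genFun_one, len_one, pow_zero, one_mul, shiftedMatrix_zero] at h
  rw [growthSeries_eq, mul_comm, ← h]

end ArtinTitsB

theorem theoremT (n : ℕ) :
    (∀ k : ℕ, (atomSphere (ArtinTitsB n) k).Finite) ∧
      growthSeries (ArtinTitsB n) * ((matrixB n).det : PowerSeries ℤ) = 1 := by
  refine ⟨fun k => ?_, ArtinTitsB.growthSeries_mul_det n⟩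
  rw [ArtinTitsB.atomSphere_eq]
  exact ArtinTitsB.finite_len_eq n k
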